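/- Let $d=3$ and $1<p\le 3$. For complex-valued $u\in H^1(\mathbb{R}^3)$ and $\omega>0$ put $$\mathcal S_\omega(u)=\tfrac12\|\nabla u\|_{L^2}^2+\tfrac{\omega}{2}\|u\|_{L^2}^2-\tfrac{1}{p+1}\|u\|_{L^{p+1}}^{p+1}-\tfrac16\|u\|_{L^6}^6,$$ $$\mathcal N_\omega(u)=\|\nabla u\|_{L^2}^2+\omega\|u\|_{L^2}^2-\|u\|_{L^{p+1}}^{p+1}-\|u\|_{L^6}^6,$$ and let $$m_\omega^{\mathcal N}=\inf\{\mathcal S_\omega(u): u\in H^1(\mathbb{R}^3)\setminus\{0\},\ \mathcal N_\omega(u)=0\}.$$ Let $$m_\infty=\inf\Big\{\tfrac12\|\nabla u\|_{L^2}^2-\tfrac16\|u\|_{L^6}^6:\ u\in\dot H^1(\mathbb{R}^3)\setminus\{0\},\ \|\nabla u\|_{L^2}^2=\|u\|_{L^6}^6\Big\},$$ where $\dot H^1(\mathbb{R}^3)$ is the space of all $u\in L^6(\mathbb{R}^3)$ with weak gradient in $L^2(\mathbb{R}^3)$, and let $$\omega_c^{\mathcal N}=\sup\{\omega>0:\ m_\omega^{\mathcal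 N}<m_\infty\},$$ the supremum being taken in the extended reals. Then $m_\omega^{\mathcal N}=m_\infty$ for every $\omega>0$ with $\omega\ge\omega_c^{\mathcal N}$. -/

import Mathlib

open MeasureTheory

noncomputable section

namespace ScalarField

/-- Three-dimensional Euclidean space. -/
abbrev E3 : Type := EuclideanSpace ℝ (Fin 3)

/-- `g` is the weak (distributional) gradient of the complex-valued function `u` on `ℝ³`:
both are locally integrable and `∫ u ∂ᵢφ = - ∫ gᵢ φ` for all test functions `φ ∈ C_c^∞(ℝ³)`
and every coordinate direction `i`. -/
structure HasWeakGrad (u : E3 → ℂ) (g : E3 → EuclideanSpace ℂ (Fin 3)) : Prop where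
  locInt : LocallyIntegrable u volume
  locInt_grad : LocallyIntegrable g volume
  integral_eq : ∀ φ : E3 → ℝ, ContDiff ℝ ((⊤ : ℕ∞) : WithTop ℕ∞) φ → HasCompactSupport φ → ∀ i : Fin 3,
    ∫ x, (fderiv ℝ φ x (EuclideanSpace.single i 1)) • u x = - ∫ x, φ x • g x i

open Classical in
/-- The weak gradient of `u` (and `0` if `u` has no weak gradient). It is determined up to
equality almost everywhere, see `HasWeakGrad.weakGrad_ae_eq`. -/
def weakGrad (u : E3 → ℂ) : E3 → EuclideanSpace ℂ (Fin 3) :=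
  if h : ∃ g, HasWeakGrad u g then h.choose else 0

theorem HasWeakGrad.ae_unique {u : E3 → ℂ} {g g' : E3 → EuclideanSpace ℂ (Fin 3)}
    (h : HasWeakGrad u g) (h' : HasWeakGrad u g') : g =ᵐ[volume] g' := by
  have hc : ∀ (f : E3 → EuclideanSpace ℂ (Fin 3)) (i : Fin 3), LocallyIntegrable f volume →
      LocallyIntegrable (fun x => f x i) volume := by
    intro f i hf x
    obtain ⟨s, hs, hfs⟩ := hf x
    exact ⟨s, hs, (EuclideanSpace.proj (𝕜 := ℂ) i).integrable_comp hfs⟩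
  have hi : ∀ i : Fin 3, ∀ᵐ x ∂(volume : Measure E3), g x i = g' x i := by
    intro i
    refine ae_eq_of_integral_contDiff_smul_eq (hc g i h.locInt_grad) (hc g' i h'.locInt_grad) ?_
    intro φ hφ hφc
    have h1 := h.integral_eq φ hφ hφc i
    have h2 := h'.integral_eq φ hφ hφc i
    exact neg_injective (h1.symm.trans h2)
  filter_upwards [ae_all_iff.2 hi] with x hx
  ext i
  exact hx i

theorem HasWeakGrad.weakGrad_ae_eq {u : E3 → ℂ} {g : E3 → EuclideanSpace ℂ (Fin 3)}
    (h : HasWeakGrad u g) : weakGrad u =ᵐ[volume] g := by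
  have hex : ∃ g, HasWeakGrad u g := ⟨g, h⟩
  unfold weakGrad
  rw [dif_pos hex]
  exact hex.choose_spec.ae_unique h

/-- `u ∈ H¹(ℝ³)`: `u ∈ L²` and `u` has a weak gradient in `L²`. -/
def MemH1 (u : E3 → ℂ) : Prop :=
  MemLp u 2 volume ∧ ∃ g, HasWeakGrad u g ∧ MemLp g 2 volume

/-- `u ∈ Ḣ¹(ℝ³)`: `u ∈ L⁶` (six is the critical Sobolev exponent in dimension three) and `u` has
a weak gradient in `L²`. -/
def MemHomH1 (u : E3 → ℂ) : Prop :=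
  MemLp u 6 volume ∧ ∃ g, HasWeakGrad u g ∧ MemLp g 2 volume

/-- `‖∇u‖_{L²}²`. -/
def gradSq (u : E3 → ℂ) : ℝ := ∫ x, ‖weakGrad u x‖ ^ (2 : ℕ)

/-- `‖u‖_{L^q}^q`. Only used where `u ∈ L^q`. In particular functions in `H¹(ℝ³)` lie in `L^q`
for all `2 ≤ q ≤ 6`. -/
def powNorm (q : ℝ) (u : E3 → ℂ) : ℝ := ∫ x, ‖u x‖ ^ q

/-- The action `S_ω` in dimension three. -/
def action (p ω : ℝ) (u : E3 → ℂ) : ℝ :=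
  (1 / 2) * gradSq u + (ω / 2) * powNorm 2 u - (1 / (p + 1)) * powNorm (p + 1) u
    - (1 / 6) * powNorm 6 u

/-- The Nehari functional `N_ω` in dimension three. -/
def nehari (p ω : ℝ) (u : E3 → ℂ) : ℝ :=
  gradSq u + ω * powNorm 2 u - powNorm (p + 1) u - powNorm 6 u

/-- The functional `H^‡` in dimension three. -/
def actionInf (u : E3 → ℂ) : ℝ := (1 / 2) * gradSq u - (1 / 6) * powNorm 6 u

/-- The functional `N^‡` in dimension three. -/
def nehariInf (u : E3 → ℂ) : ℝ := gradSq u - powNorm 6 u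

/-- The ground-state level `m_ω^N`. -/
def mN (p ω : ℝ) : ℝ :=
  sInf {s : ℝ | ∃ u : E3 → ℂ, MemH1 u ∧ ¬ u =ᵐ[volume] 0 ∧ nehari p ω u = 0 ∧ s = action p ω u}

/-- The Sobolev level `m_∞`. -/
def mInf : ℝ :=
  sInf {s : ℝ | ∃ u : E3 → ℂ, MemHomH1 u ∧ ¬ u =ᵐ[volume] 0 ∧ nehariInf u = 0 ∧ s = actionInf u}

/-- The threshold frequency `ω_c^N`, a supremum in the extended reals. -/
def omegaC (p : ℝ) : EReal :=
  sSup {a : EReal | ∃ ω : ℝ, 0 < ω ∧ mN p ω < mInf ∧ a = (ω : EReal)}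

end ScalarField

end

noncomputable section

namespace ScalarField

open Filter Topology Set
open scoped ENNReal

/-! ### Calculus of weak gradients -/

/-! Two facts suffice; neither needs attained infima or monotonicity in ω.

First, m_ω ≤ m_∞ for every ω > 0 (`mN_le_mInf`). A competitor v for m_∞ is cut off to an H¹ function
with nearly the same ‖∇v‖₂ and ‖v‖₆, then concentrated by the Ḣ¹-invariant scaling until its mass
term is negligible, and finally multiplied by a scalar to reach the Nehari manifold. The L^{p+1}
term only lowers the action, so the result is at most the action of v plus ε.

Second, {ω : m_ω < m_∞} is open to the right (`exists_gt_mN_lt_mInf`). If u on the Nehari manifold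
has action below m_∞, then T • u with T slightly above 1 lies on the manifold of a larger frequency.
On the manifold the action is a nonnegative combination of ‖u‖_{p+1}^{p+1} and ‖u‖₆⁶, so it grows by
at most the factor T⁶.

Hence m_ω < m_∞ with ω ≥ ω_c would give some ω' > ω in the set defining ω_c, contradicting the
supremum; this covers ω = ω_c too. Sobolev's inequality is not used: the L^{p+1} integral enters
only through its sign and homogeneity. -/

theorem HasWeakGrad.gradSq_eq {u : E3 → ℂ} {g : E3 → EuclideanSpace ℂ (Fin 3)}
    (h : HasWeakGrad u g) : gradSq u = ∫ x, ‖g x‖ ^ (2 : ℕ) := by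
  refine integral_congr_ae ?_
  filter_upwards [h.weakGrad_ae_eq] with x hx
  rw [hx]

theorem gradSq_nonneg (u : E3 → ℂ) : 0 ≤ gradSq u :=
  integral_nonneg fun _ => by positivity

theorem powNorm_nonneg (q : ℝ) (u : E3 → ℂ) : 0 ≤ powNorm q u :=
  integral_nonneg fun _ => by positivity

theorem HasWeakGrad.const_smul {u : E3 → ℂ} {g : E3 → EuclideanSpace ℂ (Fin 3)}
    (h : HasWeakGrad u g) (c : ℝ) : HasWeakGrad (c • u) (c • g) := by
  refine ⟨h.locInt.smul c, h.locInt_grad.smul c, fun φ hφ hφc i => ?_⟩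
  have h1 := h.integral_eq φ hφ hφc i
  have e1 : (fun x => (fderiv ℝ φ x (EuclideanSpace.single i 1)) • (c • u) x)
      = fun x => c • ((fderiv ℝ φ x (EuclideanSpace.single i 1)) • u x) := by
    funext x; simp only [Pi.smul_apply]; rw [smul_comm]
  have e2 : (fun x => φ x • (c • g) x i) = fun x => c • (φ x • g x i) := by
    funext x; simp only [Pi.smul_apply, PiLp.smul_apply]; rw [smul_comm]
  rw [e1, e2, integral_smul, integral_smul, h1, smul_neg]

theorem powNorm_smul (q : ℝ) {c : ℝ} (hc : 0 ≤ c) (u : E3 → ℂ) :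
    powNorm q (c • u) = c ^ q * powNorm q u := by
  unfold powNorm
  rw [← integral_const_mul]
  refine integral_congr_ae (Eventually.of_forall fun x => ?_)
  simp only [Pi.smul_apply, norm_smul, Real.norm_of_nonneg hc]
  rw [Real.mul_rpow hc (norm_nonneg _)]

theorem HasWeakGrad.gradSq_smul {u : E3 → ℂ} {g : E3 → EuclideanSpace ℂ (Fin 3)}
    (h : HasWeakGrad u g) (c : ℝ) : gradSq (c • u) = c ^ 2 * gradSq u := by
  rw [(h.const_smul c).gradSq_eq, h.gradSq_eq, ← integral_const_mul]
  refine integral_congr_ae (Eventually.of_forall fun x => ?_)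
  simp only [Pi.smul_apply, norm_smul, mul_pow, Real.norm_eq_abs, sq_abs]

theorem MemH1.const_smul {u : E3 → ℂ} (h : MemH1 u) (c : ℝ) : MemH1 (c • u) := by
  obtain ⟨h2, g, hg, hg2⟩ := h
  exact ⟨h2.const_smul c, c • g, hg.const_smul c, hg2.const_smul c⟩

theorem MemHomH1.const_smul {u : E3 → ℂ} (h : MemHomH1 u) (c : ℝ) : MemHomH1 (c • u) := by
  obtain ⟨h2, g, hg, hg2⟩ := h
  exact ⟨h2.const_smul c, c • g, hg.const_smul c, hg2.const_smul c⟩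

/-! ### Dilations. -/

theorem locallyIntegrable_comp_smul {F : Type*} [NormedAddCommGroup F] {f : E3 → F}
    (hf : LocallyIntegrable f volume) {r : ℝ} (hr : 0 < r) :
    LocallyIntegrable (fun x => f (r • x)) volume := by
  have h := locallyIntegrable_map_homeomorph (Homeomorph.smulOfNeZero (α := E3) r hr.ne')
    (f := f) (μ := volume)
  refine h.1 ?_
  have hm : Measure.map (Homeomorph.smulOfNeZero (α := E3) r hr.ne') volume
      = ENNReal.ofReal |(r ^ Module.finrank ℝ E3)⁻¹| • (volume : Measure E3) :=
    Measure.map_addHaar_smul volume hr.ne'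
  rw [hm]
  intro x
  obtain ⟨s, hs, hfs⟩ := hf x
  refine ⟨s, hs, ?_⟩
  unfold IntegrableOn
  rw [Measure.restrict_smul]
  exact hfs.smul_measure ENNReal.ofReal_ne_top

theorem memLp_comp_smul {F : Type*} [NormedAddCommGroup F] {f : E3 → F} {q : ℝ≥0∞}
    (hf : MemLp f q volume) {r : ℝ} (hr : 0 < r) :
    MemLp (fun x => f (r • x)) q volume := by
  have hm : Measure.map (Homeomorph.smulOfNeZero (α := E3) r hr.ne') volume
      = ENNReal.ofReal |(r ^ Module.finrank ℝ E3)⁻¹| • (volume : Measure E3) :=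
    Measure.map_addHaar_smul volume hr.ne'
  have h2 : MemLp f q (Measure.map (Homeomorph.smulOfNeZero (α := E3) r hr.ne') volume) := by
    rw [hm]
    exact hf.smul_measure ENNReal.ofReal_ne_top
  exact h2.comp_of_map (Homeomorph.smulOfNeZero (α := E3) r hr.ne').continuous.aemeasurable

theorem integral_comp_dilation {F : Type*} [NormedAddCommGroup F] [NormedSpace ℝ F]
    (f : E3 → F) {r : ℝ} (hr : 0 < r) :
    ∫ x, f (r • x) = (r ^ 3)⁻¹ • ∫ x, f x := by
  have := Measure.integral_comp_smul_of_nonneg (volume : Measure E3) f r (hR := hr.le)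
  rw [this]
  simp

theorem fderiv_comp_dilation (φ : E3 → ℝ) (hφ : Differentiable ℝ φ) (r : ℝ) (x v : E3) :
    fderiv ℝ (fun y => φ (r • y)) x v = r * fderiv ℝ φ (r • x) v := by
  have h : HasFDerivAt (fun y : E3 => φ (r • y))
      ((fderiv ℝ φ (r • x)).comp (r • ContinuousLinearMap.id ℝ E3)) x :=
    ((hφ (r • x)).hasFDerivAt).comp x ((hasFDerivAt_id x).const_smul r)
  rw [h.fderiv]
  simp

theorem hasCompactSupport_comp_dilation {F : Type*} [Zero F] {φ : E3 → F}
    (hφ : HasCompactSupport φ) {r : ℝ} (hr : 0 < r) :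
    HasCompactSupport (fun x => φ (r • x)) :=
  hφ.comp_homeomorph (Homeomorph.smulOfNeZero (α := E3) r hr.ne')

theorem HasWeakGrad.comp_dilation {u : E3 → ℂ} {g : E3 → EuclideanSpace ℂ (Fin 3)}
    (h : HasWeakGrad u g) {r : ℝ} (hr : 0 < r) :
    HasWeakGrad (fun x => u (r • x)) (fun x => r • g (r • x)) := by
  refine ⟨locallyIntegrable_comp_smul h.locInt hr,
    (locallyIntegrable_comp_smul h.locInt_grad hr).smul r, fun φ hφ hφc i => ?_⟩
  have h1 := h.integral_eq (fun y => φ (r⁻¹ • y)) (hφ.comp (contDiff_const_smul _))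
    (hasCompactSupport_comp_dilation hφc (inv_pos.2 hr)) i
  have hd := hφ.differentiable (by simp)
  have e1 := integral_comp_dilation (fun y => (fderiv ℝ (fun y => φ (r⁻¹ • y)) y
    (EuclideanSpace.single i 1)) • u y) hr
  have e2 := integral_comp_dilation (fun y => φ (r⁻¹ • y) • g y i) hr
  rw [h1, smul_neg, ← e2] at e1
  simp only [fderiv_comp_dilation φ hd, smul_smul, inv_mul_cancel₀ hr.ne', one_smul] at e1
  have e3 : (fun x => (fderiv ℝ φ x (EuclideanSpace.single i 1)) • u (r • x))
      = fun x => r • ((r⁻¹ * fderiv ℝ φ x (EuclideanSpace.single i 1)) • u (r • x)) := by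
    funext x
    rw [smul_smul, mul_inv_cancel_left₀ hr.ne']
  have e4 : (fun x => φ x • (r • g (r • x)) i) = fun x => r • (φ x • g (r • x) i) := by
    funext x; simp only [PiLp.smul_apply]; rw [smul_comm]
  rw [e3, e4, integral_smul, integral_smul, e1, smul_neg]

/-- The classical gradient of a real-valued function, as a complex vector. -/
def cgrad (φ : E3 → ℝ) (x : E3) : EuclideanSpace ℂ (Fin 3) :=
  WithLp.toLp 2 fun i => ((fderiv ℝ φ x (EuclideanSpace.single i 1) : ℝ) : ℂ)

theorem continuous_cgrad {φ : E3 → ℝ} (hφ : ContDiff ℝ ((⊤ : ℕ∞) : WithTop ℕ∞) φ) :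
    Continuous (cgrad φ) := by
  have h := hφ.continuous_fderiv (by simp)
  unfold cgrad
  refine (PiLp.continuous_toLp 2 _).comp (continuous_pi fun i => ?_)
  fun_prop

theorem cgrad_eq_zero_of_fderiv {φ : E3 → ℝ} {x : E3} (h : fderiv ℝ φ x = 0) :
    cgrad φ x = 0 := by
  ext i
  simp [cgrad, h]

theorem hasCompactSupport_cgrad {φ : E3 → ℝ} (hφ : HasCompactSupport φ) :
    HasCompactSupport (cgrad φ) :=
  (hφ.fderiv ℝ).mono fun _ hx h => hx (cgrad_eq_zero_of_fderiv h)

theorem cgrad_comp_dilation {φ : E3 → ℝ} (hφ : Differentiable ℝ φ) (r : ℝ) (x : E3) :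
    cgrad (fun y => φ (r • y)) x = r • cgrad φ (r • x) := by
  ext i
  simp [cgrad, fderiv_comp_dilation φ hφ]

/-- Product rule: test the weak gradient of u against φχ and move the term containing ∂ᵢχ to the
other side. -/
theorem HasWeakGrad.cutoff {u : E3 → ℂ} {g : E3 → EuclideanSpace ℂ (Fin 3)}
    (h : HasWeakGrad u g) {χ : E3 → ℝ} (hχ : ContDiff ℝ ((⊤ : ℕ∞) : WithTop ℕ∞) χ)
    (hχc : HasCompactSupport χ) :
    HasWeakGrad (fun x => χ x • u x) (fun x => χ x • g x + u x • cgrad χ x) := by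
  have hI : Integrable (fun x => χ x • u x) :=
    h.locInt.integrable_smul_left_of_hasCompactSupport hχ.continuous hχc
  have hI2 : Integrable (fun x => χ x • g x) :=
    h.locInt_grad.integrable_smul_left_of_hasCompactSupport hχ.continuous hχc
  have hI3 : Integrable (fun x => u x • cgrad χ x) :=
    h.locInt.integrable_smul_right_of_hasCompactSupport (continuous_cgrad hχ)
      (hasCompactSupport_cgrad hχc)
  refine ⟨hI.locallyIntegrable, (hI2.add hI3).locallyIntegrable, fun φ hφ hφc i => ?_⟩
  set e : E3 := EuclideanSpace.single i 1 with he
  have hχd := hχ.differentiable (by simp)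
  have hφd := hφ.differentiable (by simp)
  have h1 := h.integral_eq (fun x => φ x * χ x) (hφ.mul hχ) (hφc.mul_right) i
  have hfd : ∀ x, fderiv ℝ (fun x => φ x * χ x) x e
      = φ x * fderiv ℝ χ x e + χ x * fderiv ℝ φ x e := by
    intro x
    rw [fderiv_fun_mul (hφd x) (hχd x)]
    simp
  have hgi : LocallyIntegrable (fun x => g x i) volume := by
    intro x
    obtain ⟨s, hs, hfs⟩ := h.locInt_grad x
    exact ⟨s, hs, (EuclideanSpace.proj (𝕜 := ℂ) i).integrable_comp hfs⟩
  have hcφ : Continuous fun x => fderiv ℝ φ x e := (hφ.continuous_fderiv (by simp)).clm_apply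
    continuous_const
  have hcχ : Continuous fun x => fderiv ℝ χ x e := (hχ.continuous_fderiv (by simp)).clm_apply
    continuous_const
  have J1 : Integrable fun x => (φ x * fderiv ℝ χ x e) • u x :=
    h.locInt.integrable_smul_left_of_hasCompactSupport (hφ.continuous.mul hcχ) hφc.mul_right
  have J2 : Integrable fun x => (χ x * fderiv ℝ φ x e) • u x :=
    h.locInt.integrable_smul_left_of_hasCompactSupport (hχ.continuous.mul hcφ) hχc.mul_right
  have J3 : Integrable fun x => (φ x * χ x) • g x i :=
    hgi.integrable_smul_left_of_hasCompactSupport (hφ.continuous.mul hχ.continuous) hφc.mul_right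
  rw [← he] at h1
  simp only [hfd, add_smul] at h1
  rw [integral_add J1 J2] at h1
  have e1 : (fun x => (fderiv ℝ φ x e) • χ x • u x) = fun x => (χ x * fderiv ℝ φ x e) • u x := by
    funext x; rw [smul_smul, mul_comm]
  have e2 : (fun x => φ x • (χ x • g x + u x • cgrad χ x) i)
      = fun x => (φ x * χ x) • g x i + (φ x * fderiv ℝ χ x e) • u x := by
    funext x
    simp only [PiLp.add_apply, PiLp.smul_apply, cgrad, smul_add, he, smul_eq_mul,
      Complex.real_smul]
    push_cast
    ring
  rw [e1, e2, integral_add J3 J1, neg_add, ← h1]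
  abel

theorem hasWeakGrad_of_contDiff {χ : E3 → ℝ} (hχ : ContDiff ℝ ((⊤ : ℕ∞) : WithTop ℕ∞) χ)
    (hχc : HasCompactSupport χ) : HasWeakGrad (fun x => (χ x : ℂ)) (cgrad χ) := by
  -- The constant 1 has weak gradient 0; cutting it off by χ gives the claim.
  have h1 : HasWeakGrad (fun _ => (1 : ℂ)) (fun _ => 0) := by
    refine ⟨locallyIntegrable_const _, locallyIntegrable_const _, fun φ hφ hφc i => ?_⟩
    have h := integral_mul_fderiv_eq_neg_fderiv_mul_of_integrable (𝕜 := ℝ)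
      (μ := (volume : Measure E3))
      (f := fun _ => (1 : ℝ)) (g := φ) (v := EuclideanSpace.single i 1) (by simp)
      (by
        simp only [one_mul]
        exact ((hφ.continuous_fderiv (by simp)).clm_apply
          continuous_const).integrable_of_hasCompactSupport (hφc.fderiv_apply ℝ _))
      (by simpa using hφ.continuous.integrable_of_hasCompactSupport hφc)
      (fun _ _ => by fun_prop) (fun x _ => hφ.differentiable (by simp) x)
    simp only [one_mul, fderiv_fun_const, Pi.zero_apply, zero_apply, zero_mul,
      integral_zero, neg_zero] at h
    have := integral_smul_const (μ := (volume : Measure E3))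
      (fun x => fderiv ℝ φ x (EuclideanSpace.single i 1)) (1 : ℂ)
    rw [this, h]
    simp
  have h2 := h1.cutoff hχ hχc
  simpa using h2

/-! ### Approximation by compactly supported functions -/

theorem toReal_eLpNorm_eq {F : Type*} [NormedAddCommGroup F] {f : E3 → F} {n : ℕ}
    {q : ℝ≥0∞} (hq : q = n) (hn : n ≠ 0) (hf : MemLp f q volume) :
    (eLpNorm f q volume).toReal = (∫ x, ‖f x‖ ^ n) ^ ((n : ℝ)⁻¹) := by
  subst hq
  rw [hf.eLpNorm_eq_integral_rpow_norm (by exact_mod_cast hn) (by simp), ENNReal.toReal_ofReal]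
  · simp
  · positivity

theorem integral_norm_sq_eq_toReal_eLpNorm_sq {F : Type*} [NormedAddCommGroup F] {f : E3 → F}
    (hf : MemLp f 2 volume) : ∫ x, ‖f x‖ ^ 2 = (eLpNorm f 2 volume).toReal ^ 2 := by
  have h0 : 0 ≤ ∫ x, ‖f x‖ ^ 2 := integral_nonneg fun _ => by positivity
  rw [toReal_eLpNorm_eq (n := 2) (by norm_num) two_ne_zero hf,
    Real.rpow_inv_natCast_pow h0 two_ne_zero]

theorem powNorm_natCast (n : ℕ) (u : E3 → ℂ) : powNorm n u = ∫ x, ‖u x‖ ^ n := by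
  simp [powNorm]

theorem powNorm_six (u : E3 → ℂ) : powNorm 6 u = ∫ x, ‖u x‖ ^ 6 := powNorm_natCast 6 u

theorem powNorm_two (u : E3 → ℂ) : powNorm 2 u = ∫ x, ‖u x‖ ^ 2 := powNorm_natCast 2 u

theorem integrable_norm_pow_six {F : Type*} [NormedAddCommGroup F] {f : E3 → F}
    (hf : MemLp f 6 volume) : Integrable fun x => ‖f x‖ ^ 6 := by
  have h : MemLp f ((6 : ℕ) : ℝ≥0∞) volume := by
    rw [Nat.cast_ofNat]; exact hf
  exact h.integrable_norm_pow (by norm_num)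

/-- A smooth cutoff equal to one on the unit ball. -/
def bump : ContDiffBump (0 : E3) := ⟨1, 2, one_pos, one_lt_two⟩

theorem contDiff_bump : ContDiff ℝ ((⊤ : ℕ∞) : WithTop ℕ∞) (bump : E3 → ℝ) := bump.contDiff

/-- The cutoff at scale `n + 1`. -/
def cut (n : ℕ) (x : E3) : ℝ := bump (((n : ℝ) + 1)⁻¹ • x)

theorem cut_scale_pos (n : ℕ) : 0 < ((n : ℝ) + 1)⁻¹ := by positivity

theorem contDiff_cut (n : ℕ) : ContDiff ℝ ((⊤ : ℕ∞) : WithTop ℕ∞) (cut n) :=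
  contDiff_bump.comp (contDiff_const_smul _)

theorem hasCompactSupport_cut (n : ℕ) : HasCompactSupport (cut n) :=
  hasCompactSupport_comp_dilation bump.hasCompactSupport (cut_scale_pos n)

theorem norm_cut_smul_le {F : Type*} [NormedAddCommGroup F] [NormedSpace ℝ F] (n : ℕ) (x : E3)
    (y : F) : ‖cut n x • y‖ ≤ ‖y‖ := by
  rw [norm_smul, Real.norm_of_nonneg (show 0 ≤ cut n x from bump.nonneg)]
  exact mul_le_of_le_one_left (norm_nonneg _) bump.le_one

theorem tendsto_cut_scale (x : E3) :
    Tendsto (fun n : ℕ => ‖((n : ℝ) + 1)⁻¹ • x‖) atTop (𝓝 0) := by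
  have h : Tendsto (fun n : ℕ => ((n : ℝ) + 1)⁻¹) atTop (𝓝 0) := by
    simpa [one_div] using tendsto_one_div_add_atTop_nhds_zero_nat (𝕜 := ℝ)
  simpa using (h.smul_const x).norm

theorem eventually_cut_eq_one (x : E3) : ∀ᶠ n in atTop, cut n x = 1 := by
  filter_upwards [(tendsto_cut_scale x).eventually (gt_mem_nhds one_pos)] with n hn
  exact bump.one_of_mem_closedBall (by
    rw [mem_closedBall_zero_iff]
    exact hn.le)

theorem cgrad_bump_eq_zero {y : E3} (hy : ‖y‖ < 1) : cgrad bump y = 0 := by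
  refine cgrad_eq_zero_of_fderiv ?_
  have h : (bump : E3 → ℝ) =ᶠ[𝓝 y] fun _ => 1 :=
    bump.eventuallyEq_one_of_mem_ball (mem_ball_zero_iff.2 hy)
  rw [h.fderiv_eq]
  simp

theorem cgrad_cut (n : ℕ) (x : E3) :
    cgrad (cut n) x = ((n : ℝ) + 1)⁻¹ • cgrad bump (((n : ℝ) + 1)⁻¹ • x) :=
  cgrad_comp_dilation (contDiff_bump.differentiable (by simp)) _ x

theorem memLp_cgrad_cut (n : ℕ) (q : ℝ≥0∞) : MemLp (cgrad (cut n)) q volume :=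
  (continuous_cgrad (contDiff_cut n)).memLp_of_hasCompactSupport
    (hasCompactSupport_cgrad (hasCompactSupport_cut n))

/-- L³ is the scale-invariant norm for gradients in dimension three: the factor r³ cancels the
Jacobian r⁻³. -/
theorem integral_cgrad_cut_cube (n : ℕ) :
    ∫ x, ‖cgrad (cut n) x‖ ^ 3 = ∫ x, ‖cgrad bump x‖ ^ 3 := by
  have hr := cut_scale_pos n
  have h := integral_comp_dilation (fun y => ‖cgrad bump y‖ ^ 3) hr
  simp_rw [cgrad_cut, norm_smul, mul_pow]
  rw [integral_const_mul, h, Real.norm_of_nonneg hr.le, smul_eq_mul,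
    mul_inv_cancel_left₀ (by positivity)]

theorem eLpNorm_cgrad_cut (n : ℕ) :
    (eLpNorm (cgrad (cut n)) 3 volume).toReal = (∫ x, ‖cgrad bump x‖ ^ 3) ^ ((3 : ℝ)⁻¹) := by
  rw [toReal_eLpNorm_eq (n := 3) (by norm_num) three_ne_zero (memLp_cgrad_cut n 3),
    integral_cgrad_cut_cube, Nat.cast_ofNat]

/-- The region in which the cutoff at scale `n + 1` need not be constant. -/
def tail (n : ℕ) : Set E3 := {x | 1 ≤ ‖((n : ℝ) + 1)⁻¹ • x‖}

theorem measurableSet_tail (n : ℕ) : MeasurableSet (tail n) :=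
  measurableSet_le measurable_const (by fun_prop)

theorem tendsto_integral_tail {v : E3 → ℂ} (hv : MemLp v 6 volume) :
    Tendsto (fun n => ∫ x, ‖(tail n).indicator v x‖ ^ 6) atTop (𝓝 0) := by
  rw [← integral_zero E3 ℝ]
  refine tendsto_integral_of_dominated_convergence (fun x => ‖v x‖ ^ 6) (fun n => ?_)
    (integrable_norm_pow_six hv) (fun n => Eventually.of_forall fun x => ?_)
    (Eventually.of_forall fun x => ?_)
  · exact ((hv.1.indicator (measurableSet_tail n)).norm).pow 6
  · rw [Real.norm_of_nonneg (by positivity)]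
    gcongr
    exact norm_indicator_le_norm_self _ _
  · refine tendsto_const_nhds.congr' ?_
    filter_upwards [(tendsto_cut_scale x).eventually (gt_mem_nhds one_pos)] with n hn
    have : x ∉ tail n := fun h => absurd h (not_le.2 hn)
    simp [this]

theorem tendsto_eLpNorm_tail {v : E3 → ℂ} (hv : MemLp v 6 volume) :
    Tendsto (fun n => (eLpNorm ((tail n).indicator v) 6 volume).toReal) atTop (𝓝 0) := by
  have h2 := (tendsto_integral_tail hv).rpow_const (p := ((6 : ℕ) : ℝ)⁻¹)
    (Or.inr (inv_nonneg.2 (Nat.cast_nonneg 6)))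
  have h6 : ((6 : ℕ) : ℝ)⁻¹ ≠ 0 := inv_ne_zero (Nat.cast_ne_zero.2 (Nat.succ_ne_zero 5))
  have h6' : (6 : ℝ≥0∞) = ((6 : ℕ) : ℝ≥0∞) := Nat.cast_ofNat.symm
  rw [Real.zero_rpow h6] at h2
  have h3 (n : ℕ) : (eLpNorm ((tail n).indicator v) 6 volume).toReal
      = (∫ x, ‖(tail n).indicator v x‖ ^ 6) ^ (((6 : ℕ) : ℝ)⁻¹) :=
    toReal_eLpNorm_eq h6' (Nat.succ_ne_zero 5) (hv.indicator (measurableSet_tail n))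
  simp only [h3]
  exact h2

/-- Pairs v ∈ L⁶ with the gradient of the cutoff in L³. -/
instance holderTriple_six_three_two : ENNReal.HolderTriple 6 3 2 where
  inv_add_inv_eq_inv := by
    rw [← ENNReal.toReal_eq_toReal_iff' (by simp) (by simp),
      ENNReal.toReal_add (by simp) (by simp)]
    norm_num [ENNReal.toReal_inv]

theorem smul_cgrad_cut_eq (n : ℕ) (v : E3 → ℂ) :
    (fun x => v x • cgrad (cut n) x) = (tail n).indicator v • cgrad (cut n) := by
  funext x
  by_cases hx : x ∈ tail n
  · simp [hx]
  · have : cgrad (cut n) x = 0 := by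
      rw [cgrad_cut, cgrad_bump_eq_zero (not_le.1 hx), smul_zero]
    simp [this]

/-- Since v need not be in L², the commutator term v∇χₙ is controlled by Hölder: ‖∇χₙ‖₃ is
independent of n, while the L⁶ norm of v over the region where ∇χₙ may be nonzero tends to 0. -/
theorem MemHomH1.exists_memH1_approx {v : E3 → ℂ} (hv : MemHomH1 v) {δ : ℝ} (hδ : 0 < δ) :
    ∃ w, MemH1 w ∧ gradSq w ≤ gradSq v + δ ∧ |powNorm 6 w - powNorm 6 v| ≤ δ := by
  obtain ⟨hv6, g, hg, hg2⟩ := hv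
  set K : ℝ := (∫ x, ‖cgrad bump x‖ ^ 3) ^ ((3 : ℝ)⁻¹) with hK
  set T : ℕ → ℝ := fun n => (eLpNorm ((tail n).indicator v) 6 volume).toReal with hT
  have hTlim : Tendsto T atTop (𝓝 0) := tendsto_eLpNorm_tail hv6
  set w : ℕ → E3 → ℂ := fun n x => cut n x • v x with hw
  have hwg := fun n => hg.cutoff (contDiff_cut n) (hasCompactSupport_cut n)
  have hw6 : ∀ n, MemLp (w n) 6 volume := fun n =>
    hv6.mono ((contDiff_cut n).continuous.aestronglyMeasurable.smul hv6.1)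
      (Eventually.of_forall fun x => norm_cut_smul_le n x _)
  have hw2 : ∀ n, MemLp (w n) 2 volume := fun n =>
    (hw6 n).mono_exponent_of_measure_support_ne_top (s := tsupport (cut n))
      (fun x hx => by simp [hw, image_eq_zero_of_notMem_tsupport hx])
      (hasCompactSupport_cut n).isCompact.measure_ne_top
      (by norm_num)
  have hA : ∀ n, MemLp (fun x => cut n x • g x) 2 volume := fun n =>
    hg2.mono ((contDiff_cut n).continuous.aestronglyMeasurable.smul hg2.1)
      (Eventually.of_forall fun x => norm_cut_smul_le n x _)
  have hi6 : ∀ n, MemLp ((tail n).indicator v) 6 volume := fun n =>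
    hv6.indicator (measurableSet_tail n)
  have hB : ∀ n, MemLp (fun x => v x • cgrad (cut n) x) 2 volume := fun n => by
    rw [smul_cgrad_cut_eq]
    exact (memLp_cgrad_cut n 3).smul (hi6 n)
  have hBn : ∀ n, (eLpNorm (fun x => v x • cgrad (cut n) x) 2 volume).toReal ≤ T n * K := by
    intro n
    rw [smul_cgrad_cut_eq, hK, ← eLpNorm_cgrad_cut n, hT, ← ENNReal.toReal_mul]
    exact ENNReal.toReal_mono
      (ENNReal.mul_ne_top (hi6 n).eLpNorm_ne_top (memLp_cgrad_cut n 3).eLpNorm_ne_top)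
      (eLpNorm_smul_le_mul_eLpNorm (memLp_cgrad_cut n 3).1 (hi6 n).1)
  have hAn : ∀ n, (eLpNorm (fun x => cut n x • g x) 2 volume).toReal
      ≤ (eLpNorm g 2 volume).toReal := fun n =>
    ENNReal.toReal_mono hg2.eLpNorm_ne_top
      (eLpNorm_mono fun x => norm_cut_smul_le n x _)
  have hG : ∀ n, gradSq (w n) ≤ ((eLpNorm g 2 volume).toReal + T n * K) ^ 2 := by
    intro n
    have h := integral_norm_sq_eq_toReal_eLpNorm_sq ((hA n).add (hB n))
    simp only [Pi.add_apply] at h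
    rw [(hwg n).gradSq_eq, h]
    gcongr
    refine le_trans (ENNReal.toReal_mono ?_
      (eLpNorm_add_le (hA n).1 (hB n).1 one_le_two)) ?_
    · exact ENNReal.add_ne_top.2 ⟨(hA n).eLpNorm_ne_top, (hB n).eLpNorm_ne_top⟩
    · rw [ENNReal.toReal_add (hA n).eLpNorm_ne_top (hB n).eLpNorm_ne_top]
      exact add_le_add (hAn n) (hBn n)
  have hGlim : Tendsto (fun n => ((eLpNorm g 2 volume).toReal + T n * K) ^ 2) atTop
      (𝓝 (gradSq v)) := by
    have := ((hTlim.mul_const K).const_add (eLpNorm g 2 volume).toReal).pow 2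
    rwa [zero_mul, add_zero, ← integral_norm_sq_eq_toReal_eLpNorm_sq hg2, ← hg.gradSq_eq] at this
  have hQlim : Tendsto (fun n => powNorm 6 (w n)) atTop (𝓝 (powNorm 6 v)) := by
    simp only [powNorm_six]
    refine tendsto_integral_of_dominated_convergence (fun x => ‖v x‖ ^ 6) (fun n => ?_)
      (integrable_norm_pow_six hv6) (fun n => Eventually.of_forall fun x => ?_)
      (Eventually.of_forall fun x => ?_)
    · exact (hw6 n).1.norm.pow 6
    · rw [Real.norm_of_nonneg (by positivity)]
      gcongr
      exact norm_cut_smul_le n x _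
    · refine tendsto_const_nhds.congr' ?_
      filter_upwards [eventually_cut_eq_one x] with n hn
      simp [hw, hn]
  obtain ⟨n, hn1, hn2⟩ := ((hGlim.eventually (gt_mem_nhds (lt_add_of_pos_right _ hδ))).and
    (hQlim.eventually (Metric.closedBall_mem_nhds _ hδ))).exists
  exact ⟨w n, ⟨hw2 n, _, hwg n, (hA n).add (hB n)⟩, (hG n).trans hn1.le,
    by simpa [Real.dist_eq] using hn2⟩

/-! ### The Nehari manifold -/

theorem powNorm_six_pos {u : E3 → ℂ} (hu : MemLp u 6 volume) (h0 : ¬ u =ᵐ[volume] 0) :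
    0 < powNorm 6 u := by
  refine (powNorm_nonneg 6 u).lt_of_ne' fun h => h0 ?_
  rw [powNorm_six, integral_eq_zero_iff_of_nonneg (fun _ => by positivity)
    (integrable_norm_pow_six hu)] at h
  filter_upwards [h] with x hx
  simpa using hx

theorem powNorm_two_pos {u : E3 → ℂ} (hu : MemLp u 2 volume) (h0 : ¬ u =ᵐ[volume] 0) :
    0 < powNorm 2 u := by
  refine (powNorm_nonneg 2 u).lt_of_ne' fun h => h0 ?_
  rw [powNorm_two, integral_eq_zero_iff_of_nonneg (fun _ => by positivity)
    ((memLp_two_iff_integrable_sq_norm hu.1).1 hu)] at h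
  filter_upwards [h] with x hx
  simpa using hx

theorem not_ae_eq_zero_of_powNorm_six_pos {u : E3 → ℂ} (h : 0 < powNorm 6 u) :
    ¬ u =ᵐ[volume] 0 := by
  intro h0
  refine h.ne' ?_
  rw [powNorm_six, ← integral_zero E3 ℝ]
  refine integral_congr_ae ?_
  filter_upwards [h0] with x hx
  simp [hx]

theorem not_ae_eq_zero_const_smul {u : E3 → ℂ} (h : ¬ u =ᵐ[volume] 0) {c : ℝ} (hc : c ≠ 0) :
    ¬ c • u =ᵐ[volume] 0 := by
  intro h0
  refine h ?_
  filter_upwards [h0] with x hx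
  simpa [hc] using hx

theorem MemH1.gradSq_smul {u : E3 → ℂ} (h : MemH1 u) (c : ℝ) :
    gradSq (c • u) = c ^ 2 * gradSq u := by
  obtain ⟨-, g, hg, -⟩ := h
  exact hg.gradSq_smul c

theorem MemHomH1.gradSq_smul {u : E3 → ℂ} (h : MemHomH1 u) (c : ℝ) :
    gradSq (c • u) = c ^ 2 * gradSq u := by
  obtain ⟨-, g, hg, -⟩ := h
  exact hg.gradSq_smul c

theorem powNorm_two_smul {c : ℝ} (hc : 0 ≤ c) (u : E3 → ℂ) :
    powNorm 2 (c • u) = c ^ 2 * powNorm 2 u := by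
  rw [powNorm_smul 2 hc]; norm_cast

theorem powNorm_six_smul {c : ℝ} (hc : 0 ≤ c) (u : E3 → ℂ) :
    powNorm 6 (c • u) = c ^ 6 * powNorm 6 u := by
  rw [powNorm_smul 6 hc]; norm_cast

/-- The values of the action on the Nehari manifold. -/
def nehariValues (p ω : ℝ) : Set ℝ :=
  {s : ℝ | ∃ u : E3 → ℂ, MemH1 u ∧ ¬ u =ᵐ[volume] 0 ∧ nehari p ω u = 0 ∧ s = action p ω u}

/-- Subtracting half the Nehari functional removes both quadratic terms. -/
theorem action_eq_of_nehari_eq_zero {p ω : ℝ} {u : E3 → ℂ} (h : nehari p ω u = 0) :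
    action p ω u = (1 / 2 - 1 / (p + 1)) * powNorm (p + 1) u + powNorm 6 u / 3 := by
  unfold nehari at h
  unfold action
  linear_combination (1 / 2) * h

theorem half_sub_nonneg {p : ℝ} (hp : 1 < p) : 0 ≤ 1 / 2 - 1 / (p + 1) := by
  rw [sub_nonneg]
  exact one_div_le_one_div_of_le two_pos (by linarith)

theorem nehariValues_nonneg {p ω : ℝ} (hp : 1 < p) {s : ℝ} (hs : s ∈ nehariValues p ω) :
    0 ≤ s := by
  obtain ⟨u, -, -, hN, rfl⟩ := hs
  rw [action_eq_of_nehari_eq_zero hN]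
  have h1 := mul_nonneg (half_sub_nonneg hp) (powNorm_nonneg (p + 1) u)
  have h2 := powNorm_nonneg 6 u
  positivity

theorem mN_le_of_mem {p ω : ℝ} (hp : 1 < p) {s : ℝ} (hs : s ∈ nehariValues p ω) :
    mN p ω ≤ s :=
  csInf_le ⟨0, fun _ h => nehariValues_nonneg hp h⟩ hs

theorem nehari_smul_eq_zero {p ω : ℝ} {u : E3 → ℂ} (hu : MemH1 u) {t : ℝ} (ht : 0 < t)
    (h : t ^ (p - 1) * powNorm (p + 1) u + t ^ 4 * powNorm 6 u
      = gradSq u + ω * powNorm 2 u) : nehari p ω (t • u) = 0 := by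
  unfold nehari
  have e : t ^ (p + 1) = t ^ 2 * t ^ (p - 1) := by
    rw [← Real.rpow_natCast t 2, ← Real.rpow_add ht]
    congr 1
    push_cast
    ring
  rw [hu.gradSq_smul, powNorm_two_smul ht.le, powNorm_six_smul ht.le, powNorm_smul _ ht.le, e]
  linear_combination (-t ^ 2) * h

/-- The scalar t projecting u onto the manifold comes from the intermediate value theorem on [0, 2].
With Q = ‖u‖₆⁶ and the L^{p+1} term dropped, the action is at most (t²/2 − t⁶/6)Q + t²δ/2, and t²/2
− t⁶/6 ≤ 1/3. -/
theorem exists_mem_nehariValues_le {p ω δ : ℝ} (hp : 1 < p) (hω : 0 < ω) {u : E3 → ℂ}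
    (hu : MemH1 u) (hQ : 0 < powNorm 6 u) (hδ : 0 < δ) (hδQ : δ ≤ powNorm 6 u)
    (hA : gradSq u + ω * powNorm 2 u ≤ powNorm 6 u + δ) :
    ∃ s ∈ nehariValues p ω, s ≤ powNorm 6 u / 3 + δ := by
  have h0 := not_ae_eq_zero_of_powNorm_six_pos hQ
  have hM := powNorm_two_pos hu.1 h0
  have hG := gradSq_nonneg u
  have hP := powNorm_nonneg (p + 1) u
  set A := gradSq u + ω * powNorm 2 u with hAdef
  have hApos : 0 < A := by positivity
  have hcont : Continuous fun t : ℝ =>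
      t ^ (p - 1) * powNorm (p + 1) u + t ^ 4 * powNorm 6 u :=
    ((Real.continuous_rpow_const (by linarith)).mul continuous_const).add (by fun_prop)
  obtain ⟨t, ⟨ht0, -⟩, htA⟩ := intermediate_value_Icc (zero_le_two (α := ℝ)) hcont.continuousOn
    (show A ∈ Icc _ _ by
      constructor
      · simp only [Real.zero_rpow (sub_pos.2 hp).ne']
        simpa using hApos.le
      · have h1 : 0 ≤ (2 : ℝ) ^ (p - 1) * powNorm (p + 1) u := by positivity
        linarith)
  simp only at htA
  have ht : 0 < t := by
    refine ht0.lt_of_ne fun h => hApos.ne' ?_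
    rw [← htA, ← h, Real.zero_rpow (sub_pos.2 hp).ne']
    ring
  refine ⟨action p ω (t • u), ⟨t • u, hu.const_smul t, not_ae_eq_zero_const_smul h0 ht.ne',
    nehari_smul_eq_zero hu ht htA, rfl⟩, ?_⟩
  -- From t⁴Q ≤ A ≤ Q + δ ≤ 2Q.
  have h4 : t ^ 4 ≤ 2 := by
    have h1 : 0 ≤ t ^ (p - 1) * powNorm (p + 1) u := by positivity
    have h2 : t ^ 4 * powNorm 6 u ≤ 2 * powNorm 6 u := by linarith
    exact le_of_mul_le_mul_right h2 hQ
  have h2 : t ^ 2 ≤ 2 := by nlinarith [sq_nonneg (t ^ 2)]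
  have hPt := powNorm_nonneg (p + 1) (t • u)
  have h5 : 0 ≤ 1 / (p + 1) * powNorm (p + 1) (t • u) := by
    have : 0 < p + 1 := by linarith
    positivity
  have h6 : t ^ 2 * A ≤ t ^ 2 * (powNorm 6 u + δ) := by gcongr
  -- With s = t² this is (s − 1)²(s + 2).
  have h7 : (0 : ℝ) ≤ 2 - 3 * t ^ 2 + t ^ 6 := by
    nlinarith [mul_nonneg (sq_nonneg (t ^ 2 - 1)) (by positivity : 0 ≤ t ^ 2 + 2)]
  have h8 := mul_nonneg h7 hQ.le
  have h9 := mul_le_mul_of_nonneg_right h2 hδ.le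
  unfold action
  rw [hu.gradSq_smul, powNorm_two_smul ht.le, powNorm_six_smul ht.le]
  nlinarith

/-! ### Scaling, and passage from the Sobolev problem to the Nehari manifold. -/

theorem HasWeakGrad.gradSq_dilation {u : E3 → ℂ} {g : E3 → EuclideanSpace ℂ (Fin 3)}
    (h : HasWeakGrad u g) {r : ℝ} (hr : 0 < r) :
    gradSq (fun x => u (r • x)) = r⁻¹ * gradSq u := by
  have e := integral_comp_dilation (fun x => ‖g x‖ ^ 2) hr
  rw [(h.comp_dilation hr).gradSq_eq, h.gradSq_eq]
  simp only [norm_smul, mul_pow, Real.norm_of_nonneg hr.le]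
  rw [integral_const_mul, e, smul_eq_mul]
  field_simp

theorem powNorm_dilation (q : ℝ) (u : E3 → ℂ) {r : ℝ} (hr : 0 < r) :
    powNorm q (fun x => u (r • x)) = (r ^ 3)⁻¹ * powNorm q u :=
  integral_comp_dilation (fun x => ‖u x‖ ^ q) hr

theorem MemH1.comp_dilation {u : E3 → ℂ} (hu : MemH1 u) {r : ℝ} (hr : 0 < r) :
    MemH1 (fun x => u (r • x)) := by
  obtain ⟨h2, g, hg, hg2⟩ := hu
  exact ⟨memLp_comp_smul h2 hr, _, hg.comp_dilation hr, (memLp_comp_smul hg2 hr).const_smul r⟩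

/-- The `Ḣ¹`-invariant rescaling: it preserves `‖∇u‖₂` and `‖u‖₆` and makes the mass small. -/
theorem MemH1.exists_small_mass {u : E3 → ℂ} (hu : MemH1 u) {ω δ : ℝ} (hω : 0 < ω)
    (hδ : 0 < δ) : ∃ w, MemH1 w ∧ gradSq w = gradSq u ∧ powNorm 6 w = powNorm 6 u ∧
      ω * powNorm 2 w ≤ δ := by
  have hM := powNorm_nonneg 2 u
  -- Amplitude ρ with dilation ρ² multiplies the mass by ρ⁻⁴; this ρ gives ω‖u‖₂² ≤ δρ ≤ δρ⁴.
  set ρ : ℝ := 1 + ω * powNorm 2 u / δ with hρ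
  have hρ1 : 1 ≤ ρ := by
    have : 0 ≤ ω * powNorm 2 u / δ := by positivity
    linarith
  have hρ0 : 0 < ρ := one_pos.trans_le hρ1
  have hr : 0 < ρ ^ 2 := by positivity
  have hd := hu.comp_dilation hr
  refine ⟨ρ • fun x => u (ρ ^ 2 • x), hd.const_smul ρ, ?_, ?_, ?_⟩
  · obtain ⟨-, g, hg, -⟩ := id hu
    rw [hd.gradSq_smul, hg.gradSq_dilation hr]
    field_simp
  · rw [powNorm_six_smul hρ0.le, powNorm_dilation _ _ hr]
    field_simp
  · rw [powNorm_two_smul hρ0.le, powNorm_dilation _ _ hr]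
    have e : ω * (ρ ^ 2 * (((ρ ^ 2) ^ 3)⁻¹ * powNorm 2 u)) = ω * powNorm 2 u / ρ ^ 4 := by
      field_simp
    rw [e, div_le_iff₀ (by positivity)]
    have h1 : ρ ≤ ρ ^ 4 := le_self_pow₀ hρ1 (by norm_num)
    have h2 : ω * powNorm 2 u ≤ δ * ρ := by
      rw [hρ, mul_add, mul_div_cancel₀ _ hδ.ne']
      linarith
    exact h2.trans (by gcongr)

theorem MemHomH1.exists_mem_nehariValues_le {v : E3 → ℂ} (hv : MemHomH1 v)
    (h0 : ¬ v =ᵐ[volume] 0) (hN : nehariInf v = 0) {p ω ε : ℝ} (hp : 1 < p) (hω : 0 < ω)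
    (hε : 0 < ε) : ∃ s ∈ nehariValues p ω, s ≤ actionInf v + ε := by
  have hQ := powNorm_six_pos hv.1 h0
  unfold nehariInf at hN
  -- Errors δ in gradient, L⁶ term and mass add up to 3δ, which must not exceed ‖w‖₆⁶ ≥ ‖v‖₆⁶ − δ;
  -- the final loss is 10δ/3 ≤ ε.
  set δ := min (ε / 4) (powNorm 6 v / 4) with hδdef
  have hδ : 0 < δ := by positivity
  have hδ1 : δ ≤ ε / 4 := min_le_left _ _
  have hδ2 : δ ≤ powNorm 6 v / 4 := min_le_right _ _
  obtain ⟨w, hw, hwG, hwQ⟩ := hv.exists_memH1_approx hδ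
  obtain ⟨z, hz, hzG, hzQ, hzM⟩ := hw.exists_small_mass hω hδ
  rw [abs_le] at hwQ
  obtain ⟨s, hs, hsle⟩ := ScalarField.exists_mem_nehariValues_le (p := p) (δ := 3 * δ) hp hω hz
    (by linarith) (by linarith) (by linarith) (by linarith)
  refine ⟨s, hs, hsle.trans ?_⟩
  unfold actionInf
  linarith

/-! ### The Sobolev level -/

/-- Makes the infima genuine, as `sInf ∅ = 0` in ℝ. The witness is a multiple of the bump. -/
theorem exists_memHomH1_nehariInf_eq_zero :
    ∃ u : E3 → ℂ, MemHomH1 u ∧ ¬ u =ᵐ[volume] 0 ∧ nehariInf u = 0 := by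
  have hg := hasWeakGrad_of_contDiff contDiff_bump bump.hasCompactSupport
  set u : E3 → ℂ := fun x => ((bump x : ℝ) : ℂ) with hu
  have hcu : Continuous u := Complex.continuous_ofReal.comp bump.continuous
  have hsu : HasCompactSupport u := bump.hasCompactSupport.comp_left Complex.ofReal_zero
  have hgm : MemLp (cgrad bump) 2 volume :=
    (continuous_cgrad contDiff_bump).memLp_of_hasCompactSupport
      (hasCompactSupport_cgrad bump.hasCompactSupport)
  have hm : MemHomH1 u := ⟨hcu.memLp_of_hasCompactSupport hsu, _, hg, hgm⟩
  have hone : bump (0 : E3) = 1 := bump.one_of_mem_closedBall (by simp [bump])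
  have h0 : ¬ u =ᵐ[volume] 0 := by
    intro h
    have h1 : u 0 = 0 := congrFun ((hcu.ae_eq_iff_eq volume continuous_const).1 h) 0
    simp [hu, hone] at h1
  have hQ := powNorm_six_pos hm.1 h0
  -- A vanishing gradient would make the bump constant, yet it is 1 at the origin and 0 at distance
  -- 2.
  have hG : 0 < gradSq u := by
    refine (gradSq_nonneg u).lt_of_ne' fun h => ?_
    rw [hg.gradSq_eq, integral_eq_zero_iff_of_nonneg (fun _ => by positivity)
      ((memLp_two_iff_integrable_sq_norm hgm.1).1 hgm)] at h
    have h1 : cgrad bump =ᵐ[volume] 0 := by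
      filter_upwards [h] with x hx
      simpa using hx
    have h2 := ((continuous_cgrad contDiff_bump).ae_eq_iff_eq volume continuous_const).1 h1
    have h3 : ∀ x, fderiv ℝ (bump : E3 → ℝ) x = 0 := by
      intro x
      refine ContinuousLinearMap.coe_injective
        ((EuclideanSpace.basisFun (Fin 3) ℝ).toBasis.ext fun i => ?_)
      have := congrArg (fun y : EuclideanSpace ℂ (Fin 3) => y i) (congrFun h2 x)
      simpa [cgrad] using this
    have h4 := is_const_of_fderiv_eq_zero (contDiff_bump.differentiable (by simp)) h3 0
      (EuclideanSpace.single 0 2)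
    rw [hone, bump.zero_of_le_dist (by simp [bump])] at h4
    exact one_ne_zero h4
  set c : ℝ := (gradSq u / powNorm 6 u) ^ (((4 : ℕ) : ℝ)⁻¹) with hc
  have hcpos : 0 < c := by positivity
  have hc4 : c ^ 4 * powNorm 6 u = gradSq u := by
    rw [hc, Real.rpow_inv_natCast_pow (by positivity) (by norm_num), div_mul_cancel₀ _ hQ.ne']
  refine ⟨c • u, hm.const_smul c, not_ae_eq_zero_const_smul h0 hcpos.ne', ?_⟩
  unfold nehariInf
  rw [hm.gradSq_smul, powNorm_six_smul hcpos.le]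
  linear_combination (-c ^ 2) * hc4

theorem nehariValues_nonempty {p ω : ℝ} (hp : 1 < p) (hω : 0 < ω) :
    (nehariValues p ω).Nonempty := by
  obtain ⟨v, hv, h0, hN⟩ := exists_memHomH1_nehariInf_eq_zero
  obtain ⟨s, hs, -⟩ := hv.exists_mem_nehariValues_le h0 hN hp hω one_pos
  exact ⟨s, hs⟩

theorem mN_le_mInf {p ω : ℝ} (hp : 1 < p) (hω : 0 < ω) : mN p ω ≤ mInf := by
  obtain ⟨u, hu, hu0, huN⟩ := exists_memHomH1_nehariInf_eq_zero
  refine le_csInf ⟨_, u, hu, hu0, huN, rfl⟩ ?_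
  rintro _ ⟨v, hv, h0, hN, rfl⟩
  refine le_of_forall_pos_le_add fun ε hε => ?_
  obtain ⟨s, hs, hle⟩ := hv.exists_mem_nehariValues_le h0 hN hp hω hε
  exact (mN_le_of_mem hp hs).trans hle

/-- The set of frequencies whose level lies below the Sobolev level is open to the right. -/
theorem exists_gt_mN_lt_mInf {p ω : ℝ} (hp : 1 < p) (hp5 : p ≤ 5) (hω : 0 < ω)
    (h : mN p ω < mInf) : ∃ ω' > ω, mN p ω' < mInf := by
  obtain ⟨_, ⟨u, hu, h0, hN, rfl⟩, hlt⟩ :=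
    exists_lt_of_csInf_lt (nehariValues_nonempty hp hω) h
  have hS := action_eq_of_nehari_eq_zero hN
  have hM := powNorm_two_pos hu.1 h0
  have hG := gradSq_nonneg u
  have hP := powNorm_nonneg (p + 1) u
  have hQ := powNorm_nonneg 6 u
  -- T⁶ bounds the growth of the action along T • u, so T is taken close enough to 1 to stay below
  -- m_∞.
  have hcont : ContinuousAt (fun T : ℝ => T ^ 6 * action p ω u) 1 := by fun_prop
  have hev : ∀ᶠ T : ℝ in 𝓝[>] 1, T ^ 6 * action p ω u < mInf :=
    (hcont.eventually (gt_mem_nhds (by simpa using hlt))).filter_mono nhdsWithin_le_nhds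
  obtain ⟨T, hT, hT1⟩ := (hev.and self_mem_nhdsWithin).exists
  have hT0 : 0 < T := one_pos.trans hT1
  have hTp : 1 < T ^ (p - 1) := Real.one_lt_rpow hT1 (by linarith)
  have hT4 : 1 < T ^ 4 := one_lt_pow₀ hT1 (by norm_num)
  have hA : gradSq u + ω * powNorm 2 u = powNorm (p + 1) u + powNorm 6 u := by
    unfold nehari at hN
    linarith
  have hpos : 0 < powNorm (p + 1) u + powNorm 6 u := by
    rw [← hA]
    positivity
  have hgain : 0 < (T ^ (p - 1) - 1) * powNorm (p + 1) u + (T ^ 4 - 1) * powNorm 6 u := by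
    rcases hP.lt_or_eq with hP' | hP'
    · exact add_pos_of_pos_of_nonneg (mul_pos (by linarith) hP') (mul_nonneg (by linarith) hQ)
    · rw [← hP', zero_add] at hpos
      exact add_pos_of_nonneg_of_pos (mul_nonneg (by linarith) hP) (mul_pos (by linarith) hpos)
  -- The frequency increment that puts T • u back on the manifold, found by solving the Nehari
  -- equation for the mass coefficient.
  set η := ((T ^ (p - 1) - 1) * powNorm (p + 1) u + (T ^ 4 - 1) * powNorm 6 u) / powNorm 2 u
    with hη
  have hηM : η * powNorm 2 u
      = (T ^ (p - 1) - 1) * powNorm (p + 1) u + (T ^ 4 - 1) * powNorm 6 u :=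
    div_mul_cancel₀ _ hM.ne'
  have hN' : nehari p (ω + η) (T • u) = 0 :=
    nehari_smul_eq_zero hu hT0 (by linear_combination -hA - hηM)
  refine ⟨ω + η, lt_add_of_pos_right _ (div_pos hgain hM),
    (mN_le_of_mem hp ⟨T • u, hu.const_smul T, not_ae_eq_zero_const_smul h0 hT0.ne', hN',
      rfl⟩).trans_lt (lt_of_le_of_lt ?_ hT)⟩
  rw [action_eq_of_nehari_eq_zero hN', hS, powNorm_smul _ hT0.le, powNorm_six_smul hT0.le]
  -- Here p + 1 does not exceed the critical exponent 6.
  have hTle : T ^ (p + 1) ≤ T ^ 6 := by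
    rw [← Real.rpow_natCast T 6]
    exact Real.rpow_le_rpow_of_exponent_le hT1.le (by push_cast; linarith)
  have := mul_le_mul_of_nonneg_right hTle (mul_nonneg (half_sub_nonneg hp) hP)
  linarith

end ScalarField

end

theorem proposition3p2 (p : ℝ) (hp1 : 1 < p) (hp3 : p ≤ 3) (ω : ℝ) (hω : 0 < ω)
    (hωc : ScalarField.omegaC p ≤ (ω : EReal)) :
    ScalarField.mN p ω = ScalarField.mInf := by
  refine (ScalarField.mN_le_mInf hp1 hω).antisymm (le_of_not_gt fun hlt => ?_)
  obtain ⟨ω', hω', hlt'⟩ := ScalarField.exists_gt_mN_lt_mInf hp1 (by linarith) hω hlt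
  have h : (ω' : EReal) ≤ ScalarField.omegaC p :=
    le_sSup ⟨ω', hω.trans hω', hlt', rfl⟩
  exact absurd (EReal.coe_le_coe_iff.1 (h.trans hωc)) (not_le.2 hω')
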